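/- Let $m\ge 1$, let $S_1,\dots,S_m$ be pairwise isomorphic finite non-abelian simple groups, and let $G=S_1\times\dots\times S_m$, where each $S_t$ is also regarded as a subgroup of $G$. Equip $G^{\mathbb Z}$ with the prodiscrete topology and with the metric $d(c,c')=2^{-\min\{|j|\,:\,c_j\ne c'_j\}}$ for $c\neq c'$, $d(c,c)=0$. Let $\mathcal F:G^{\mathbb Z}\to G^{\mathbb Z}$ be a group cellular automaton (GCA), i.e. a continuous shift-commuting group endomorphism, with local rule $f\in\mathrm{Hom}(G^{2\rho+1},G)$, so that $\mathcal F(c)_i=f(c_{i-\rho},\dots,c_{i+\rho})$. Write $f=(h_{-\rho},\dots,h_\rho)$, where $h_i\in\mathrm{End}(G)$ is $h_i(g)=f(e,\dots,e,g,e,\dots,e)$ with $g$ in position $i$. Assume that $G$ is minimal with respect to $\mathcal F$: there are no non-empty disjoint sets $I,J$ with $I\cup J=\{1,\dots,m\}$, $\mathcal F\big((\prod_{t\in I}S_t)^{\mathbb Z}\big)\subseteq(\prod_{t\in I}S_t)^{\mathbb Z}$ and $\mathcal F\big((\prod_{t\in J}S_t)^{\mathbb Z}\big)\subseteq(\prod_{t\in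 J}S_t)^{\mathbb Z}$. If $\mathcal F$ is surjective, then for each $i$ one has $\mathrm{Im}(h_i)=\prod_{t\in J_i}S_t$ for a (possibly empty) set $J_i\subseteq\{1,\dots,m\}$, and there is a unique permutation $\pi_f$ of $\{1,\dots,m\}$ such that for every $t$ some $h_j$ satisfies $h_j(S_t)=S_{\pi_f(t)}$. Put $r_i=|J_i|$ and let $o$ be the order of $\pi_f$. Then: 1. $\mathcal F$ is injective if and only if $\mathcal F$ is surjective, if and only if $\bigcap_{-\rho\le i\le\rho}\mathrm{Ker}(h_i)=\{e\}$. 2. $\mathcal F$ is topologically transitive (for all non-empty open $U,V$ there is $t>0$ with $\mathcal F^t(U)\cap V\ne\emptyset$) if and only if it is surjective and $\sum_i i\,r_i\ne 0$. 3. If $\mathcal F$ is surjective, then $\mathcal F$ is sensitive to initial conditions if and only if it is topologically transitive. (Sensitive: there is $\varepsilon>0$ such that for all $\delta>0$ and all $c$ there are $c'$ with $0<d(c',c)<\delta$ and $t\in\mathbb N$ with $d(\mathcal F^t(c'),\mathcal F^t(c))\ge\varepsilon$.) 4. If $\mathcal F$ is surjective, its topological entropy is $\dfrac{\left|\sum_i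 i\,r_i\right|\log|G|}{o}$. 5. $\mathcal F$ is neither strongly transitive ($\bigcup_{t\in\mathbb N}\mathcal F^t(U)=G^{\mathbb Z}$ for every non-empty open $U$) nor positively expansive (there is $\varepsilon>0$ such that for all $c\ne c'$ some $t\in\mathbb N$ has $d(\mathcal F^t(c),\mathcal F^t(c'))\ge\varepsilon$). -/

import Mathlib

namespace GCA

section Config

variable {G : Type*}

/-- The uniformity on `G^ℤ` whose topology is the prodiscrete one (product of discrete copies
of `G`). For finite `G` this is the only uniformity inducing that (compact) topology. -/
abbrev prodiscreteUniformity (G : Type*) : UniformSpace (ℤ → G) :=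
  @Pi.uniformSpace ℤ (fun _ => G) (fun _ => ⊥)

/-- The prodiscrete topology on `G^ℤ`. -/
abbrev prodiscrete (G : Type*) : TopologicalSpace (ℤ → G) :=
  (prodiscreteUniformity G).toTopologicalSpace

/-- The shift map, `σ(c)_i = c_{i-1}`. -/
def shift (c : ℤ → G) : ℤ → G := fun i => c (i - 1)

open Classical in
/-- The Tychonoff distance: `0` if `c = c'`, and otherwise `2^{-Δ}` where `Δ` is the least `|j|`
with `c_j ≠ c'_j`. -/
noncomputable def tychonoffDist (c c' : ℤ → G) : ℝ :=
  if c = c' then 0 else (1 / 2 : ℝ) ^ sInf {n : ℕ | ∃ j : ℤ, j.natAbs = n ∧ c j ≠ c' j}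

/-- A cellular automaton: a continuous self-map of `G^ℤ` commuting with the shift. -/
def IsCA (F : (ℤ → G) → (ℤ → G)) : Prop :=
  @Continuous _ _ (prodiscrete G) (prodiscrete G) F ∧ ∀ c, F (shift c) = shift (F c)

/-- Topological transitivity. -/
def IsTransitive (F : (ℤ → G) → (ℤ → G)) : Prop :=
  ∀ U V : Set (ℤ → G), @IsOpen _ (prodiscrete G) U → @IsOpen _ (prodiscrete G) V →
    U.Nonempty → V.Nonempty → ∃ t : ℕ, 0 < t ∧ (F^[t] '' U ∩ V).Nonempty

/-- Strong transitivity. -/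
def IsStronglyTransitive (F : (ℤ → G) → (ℤ → G)) : Prop :=
  ∀ U : Set (ℤ → G), @IsOpen _ (prodiscrete G) U → U.Nonempty → ⋃ t : ℕ, F^[t] '' U = Set.univ

/-- Sensitivity to initial conditions. -/
def IsSensitive (F : (ℤ → G) → (ℤ → G)) : Prop :=
  ∃ ε : ℝ, 0 < ε ∧ ∀ δ : ℝ, 0 < δ → ∀ c : ℤ → G, ∃ c' : ℤ → G,
    0 < tychonoffDist c' c ∧ tychonoffDist c' c < δ ∧
      ∃ t : ℕ, ε ≤ tychonoffDist (F^[t] c') (F^[t] c)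

/-- Positive expansivity. -/
def IsPositivelyExpansive (F : (ℤ → G) → (ℤ → G)) : Prop :=
  ∃ ε : ℝ, 0 < ε ∧ ∀ c c' : ℤ → G, c ≠ c' →
    ∃ t : ℕ, ε ≤ tychonoffDist (F^[t] c) (F^[t] c')

/-- The topological entropy of a self-map of `G^ℤ`. -/
noncomputable def topEntropy (F : (ℤ → G) → (ℤ → G)) : EReal :=
  @Dynamics.coverEntropy (ℤ → G) (prodiscreteUniformity G) F Set.univ

end Config

section LocalRule

variable {G : Type*} [Group G]

/-- The neighbourhood `{-ρ, …, ρ}`. -/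
abbrev Window (ρ : ℕ) : Type := ↥(Finset.Icc (-(ρ : ℤ)) (ρ : ℤ))

/-- The homomorphism `f : G^{2ρ+1} → G` is a local rule of `F`:
`F(c)_i = f(c_{i-ρ}, …, c_{i+ρ})`. -/
def HasLocalRule (F : (ℤ → G) →* (ℤ → G)) {ρ : ℕ} (f : (Window ρ → G) →* G) : Prop :=
  ∀ (c : ℤ → G) (i : ℤ), F c i = f (fun j => c (i + (j : ℤ)))

/-- The component `h_j` of `f = (h_{-ρ}, …, h_ρ)`: the endomorphism `g ↦ f(e, …, e, g, e, …, e)`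
with `g` in position `j`. -/
def component {ρ : ℕ} (f : (Window ρ → G) →* G) (j : Window ρ) : G →* G :=
  f.comp (MonoidHom.mulSingle (fun _ : Window ρ => G) j)

end LocalRule

section Product

variable {m : ℕ} {S : Fin m → Type*} [∀ t, Group (S t)]

/-- The subgroup `∏_{t ∈ I} S_t` of `S_1 × ⋯ × S_m`; for `I = {t}` it is the factor `S_t`
seen as a subgroup. -/
def subproduct (S : Fin m → Type*) [∀ t, Group (S t)] (I : Set (Fin m)) :
    Subgroup (∀ t, S t) where
  carrier := {g | ∀ t, t ∉ I → g t = 1}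
  one_mem' := fun _ _ => rfl
  mul_mem' := fun ha hb t ht => by simp [ha t ht, hb t ht]
  inv_mem' := fun ha t ht => by simp [ha t ht]

/-- `F(H^ℤ) ⊆ H^ℤ`. -/
def Preserves {G : Type*} [Group G] (F : (ℤ → G) →* (ℤ → G)) (H : Subgroup G) : Prop :=
  ∀ c : ℤ → G, (∀ i, c i ∈ H) → ∀ i, F c i ∈ H

/-- `S_1 × ⋯ × S_m` is minimal with respect to `F`. -/
def IsMinimalFor (F : (ℤ → ∀ t, S t) →* (ℤ → ∀ t, S t)) : Prop :=
  ¬ ∃ I J : Set (Fin m), I.Nonempty ∧ J.Nonempty ∧ Disjoint I J ∧ I ∪ J = Set.univ ∧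
    Preserves F (subproduct S I) ∧ Preserves F (subproduct S J)

/-- The set of factors contained in the image of `h`; if `Im h` is a product of factors,
`Im h = ∏_{t ∈ J} S_t`, it is `J`. -/
def imageFactors (h : (∀ t, S t) →* (∀ t, S t)) : Set (Fin m) :=
  {t | subproduct S {t} ≤ h.range}

/-- The integer `∑_j j r_j`, where `r_j` is the number of factors in the image of `h_j`. -/
noncomputable def weightedSum {ρ : ℕ} (f : (Window ρ → ∀ t, S t) →* (∀ t, S t)) : ℤ :=
  ∑ j : Window ρ, (j : ℤ) * ((imageFactors (component f j)).ncard : ℤ)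

/-- `π` is the permutation of the factors induced by the components of `f`: each factor `S_t`
is mapped onto the factor `S_{π t}` by some `h_j`. -/
def IsFactorPerm {ρ : ℕ} (f : (Window ρ → ∀ t, S t) →* (∀ t, S t))
    (π : Equiv.Perm (Fin m)) : Prop :=
  ∀ t, ∃ j : Window ρ, (subproduct S {t}).map (component f j) = subproduct S {π t}

end Product

end GCA

/-! A homomorphism from a finite product of non-abelian simple groups of equal order to another such
group is trivial or injective on each factor. Images of distinct factors commute, so if one factor
maps onto the target, all others land in its centre, which is trivial. Hence each coordinate of `f`
reads at most one factor at one window position.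

If $\mathcal F$ is surjective, or if the kernels of the $h_i$ meet trivially, pigeonhole turns this
into a permutation: $\mathcal F(c)_i(\pi t)=\varphi_t(c_{i+w_t}(t))$ (`IsTrackRule`), which is
visibly bijective. Otherwise a non-trivial common kernel element placed in a single cell is erased
in one step.

Unions of cycles of $\pi$ are preserved, so minimality makes $\pi$ a single cycle of length $m=o$.
Thus $\mathcal F^m$ is, up to automorphisms of the factors, a shift by $N=\sum_t w_t=\sum_i i\,r_i$,
and $\mathcal F^k(c)_i$ reads only cells within $m\rho$ of $i+\lfloor k/m\rfloor N$. The dynamics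
follow: mixing of windows for $N\ne0$, equicontinuity for $N=0$, entropy $|N|\log|G|/m$ by counting
the cells read, and no positive expansivity because reading drifts in at most one direction. -/

namespace GCA

/-! ### Algebraic structure of the local rule -/

section Track

variable {m : ℕ} {S : Fin m → Type*} [∀ t, Group (S t)]

/-- A homomorphism from a finite power of `∏ S_t` to a finite non-abelian simple group of the same
order as all the `S_t` is trivial or factors through an isomorphism with one of the factors. -/
theorem eq_one_or_exists_factor {ι : Type*} [Finite ι] [DecidableEq ι] {T : Type*} [Group T]
    [Finite T] [IsSimpleGroup T] [∀ t, IsSimpleGroup (S t)] (hT : ¬ ∀ a b : T, a * b = b * a)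
    (hcard : ∀ t, Nat.card (S t) = Nat.card T) (p : (ι → ∀ t, S t) →* T) :
    (∀ x, p x = 1) ∨ ∃ (j : ι) (t : Fin m) (φ : S t ≃* T), ∀ x, p x = φ (x j t) := by
  let q : ι → ∀ t, S t →* T := fun j t =>
    (p.comp (MonoidHom.mulSingle (fun _ : ι => ∀ t, S t) j)).comp (MonoidHom.mulSingle S t)
  -- Elements supported in one factor at one position generate the finite product.
  have ext (p' : (ι → ∀ t, S t) →* T) (h : ∀ j t (a : S t),
      p (Pi.mulSingle j (Pi.mulSingle t a)) = p' (Pi.mulSingle j (Pi.mulSingle t a)))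
      (x : ι → ∀ t, S t) : p x = p' x := by
    refine (show x ∈ p.eqLocus p' from Subgroup.pi_mem_of_mulSingle_mem x fun j => ?_)
    refine (show x j ∈ (p.eqLocus p').comap (MonoidHom.mulSingle (fun _ : ι => ∀ t, S t) j) from
      Subgroup.pi_mem_of_mulSingle_mem (x j) fun t => ?_)
    exact h j t (x j t)
  by_cases hq : ∀ j t, q j t = 1
  · exact Or.inl fun x => ext 1 (fun j t a => DFunLike.congr_fun (hq j t) a) x
  push Not at hq
  obtain ⟨j, t, hjt⟩ := hq
  have hinj : Function.Injective (q j t) := by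
    rw [← MonoidHom.ker_eq_bot_iff]
    rcases (inferInstance : (q j t).ker.Normal).eq_bot_or_eq_top with h | h
    · exact h
    · exact absurd ((MonoidHom.ker_eq_top_iff).1 h) hjt
  have : Finite (S t) := Finite.of_injective _ hinj
  have hbij : Function.Bijective (q j t) :=
    (Nat.bijective_iff_injective_and_card _).2 ⟨hinj, hcard t⟩
  have hcenter : Subgroup.center T = ⊥ := by
    rcases (inferInstance : (Subgroup.center T).Normal).eq_bot_or_eq_top with h | h
    · exact h
    · refine absurd (fun a b => ?_) hT
      exact (Subgroup.mem_center_iff.1 (h ▸ Subgroup.mem_top b : b ∈ Subgroup.center T) a)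
  -- Every `b` in `T` lifts to the factor `(j, t)`, which commutes with all the others, so their
  -- images are central.
  have hother (j' : ι) (t' : Fin m) (h : ¬ (j' = j ∧ t' = t)) (a : S t') : q j' t' a = 1 := by
    rw [← Subgroup.mem_bot, ← hcenter, Subgroup.mem_center_iff]
    intro b
    obtain ⟨b, rfl⟩ := hbij.2 b
    change p _ * p _ = p _ * p _
    rw [← map_mul, ← map_mul]
    congr 1
    by_cases hj : j' = j
    · subst hj
      have ht : t ≠ t' := fun e => h ⟨rfl, e.symm⟩
      rw [← map_mul, ← map_mul]
      exact congrArg _ (Pi.mulSingle_commute ht b a).eq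
    · exact (Pi.mulSingle_commute (f := fun _ : ι => ∀ t, S t) (Ne.symm hj) _ _).eq
  refine Or.inr ⟨j, t, MulEquiv.ofBijective (q j t) hbij, fun x => ?_⟩
  refine ext ((q j t).comp ((Pi.evalMonoidHom S t).comp (Pi.evalMonoidHom (fun _ => ∀ t, S t) j)))
    (fun j' t' a => ?_) x
  by_cases h : j' = j ∧ t' = t
  · obtain ⟨rfl, rfl⟩ := h
    simp [q]
  · refine (hother j' t' h a).trans ?_
    by_cases hj : j' = j
    · subst hj
      have ht : t ≠ t' := fun e => h ⟨rfl, e.symm⟩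
      simp [ht]
    · simp [Pi.mulSingle_eq_of_ne (Ne.symm hj)]

/-- Every factor `S_t` is carried isomorphically onto the factor `S_{π t}` by the component of `f`
at position `w t`, and all other components are trivial. -/
def IsTrackRule {ρ : ℕ} (f : (Window ρ → ∀ t, S t) →* (∀ t, S t)) (π : Equiv.Perm (Fin m))
    (w : Fin m → Window ρ) (φ : ∀ t, S t ≃* S (π t)) : Prop :=
  ∀ x t, f x (π t) = φ t (x (w t) t)

section Existence

variable [∀ t, Finite (S t)] [∀ t, IsSimpleGroup (S t)] {ρ : ℕ}
  {f : (Window ρ → ∀ t, S t) →* (∀ t, S t)}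

theorem localRule_eq_one_or_exists_factor (hnonab : ∀ t, ¬ ∀ a b : S t, a * b = b * a)
    (hiso : ∀ s t, Nonempty (S s ≃* S t)) (f : (Window ρ → ∀ t, S t) →* (∀ t, S t)) (u : Fin m) :
    (∀ x, f x u = 1) ∨ ∃ (j : Window ρ) (t : Fin m) (φ : S t ≃* S u), ∀ x, f x u = φ (x j t) :=
  eq_one_or_exists_factor (hnonab u)
    (fun t => Nat.card_congr (hiso t u).some.toEquiv) ((Pi.evalMonoidHom S u).comp f)

/-- A factor read by no coordinate would lie in every kernel, and no coordinate can read two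
factors; so factor ↦ reading coordinate is injective on a finite set. -/
theorem exists_isTrackRule (hnonab : ∀ t, ¬ ∀ a b : S t, a * b = b * a)
    (hiso : ∀ s t, Nonempty (S s ≃* S t)) (hker : ⨅ j, (component f j).ker = ⊥) :
    ∃ π w φ, IsTrackRule f π w φ := by
  have key (t : Fin m) : ∃ (u : Fin m) (j : Window ρ) (φ : S t ≃* S u),
      ∀ x, f x u = φ (x j t) := by
    by_contra! hcon
    obtain ⟨a, ha⟩ := exists_ne (1 : S t)
    have hmem : (Pi.mulSingle t a : ∀ t, S t) ∈ ⨅ j, (component f j).ker := by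
      rw [Subgroup.mem_iInf]
      intro j
      rw [MonoidHom.mem_ker]
      funext u
      rcases localRule_eq_one_or_exists_factor hnonab hiso f u with h | ⟨j', t', φ, h⟩
      · exact h _
      · have ht : t' ≠ t := by
          rintro rfl
          obtain ⟨x, hx⟩ := hcon u j' φ
          exact hx (h x)
        refine (h _).trans ?_
        by_cases hj : j' = j
        · subst hj
          simp [ht]
        · simp [Pi.mulSingle_eq_of_ne hj]
    rw [hker, Subgroup.mem_bot] at hmem
    exact ha (by simpa using congrFun hmem t)
  choose σ w φ h using key
  have hσ : Function.Injective σ := by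
    intro s t hst
    by_contra hne
    obtain ⟨a, ha⟩ := exists_ne (1 : S s)
    have h1 := h s fun _ => Pi.mulSingle s a
    have h2 := h t fun _ => Pi.mulSingle s a
    rw [Pi.mulSingle_eq_of_ne (Ne.symm hne), map_one] at h2
    rw [← hst] at h2
    rw [h2, eq_comm, map_eq_one_iff _ (φ s).injective, Pi.mulSingle_eq_same] at h1
    exact ha h1
  exact ⟨Equiv.ofBijective σ (Finite.injective_iff_bijective.1 hσ), w, φ, fun x t => h t x⟩

variable {F : (ℤ → ∀ t, S t) →* (ℤ → ∀ t, S t)}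

/-- Here pigeonhole runs the other way: surjectivity makes each coordinate read a factor, and two
coordinates sharing a factor would have outputs determining each other. So every factor is read. -/
theorem iInf_ker_eq_bot_of_surjective (hnonab : ∀ t, ¬ ∀ a b : S t, a * b = b * a)
    (hiso : ∀ s t, Nonempty (S s ≃* S t)) (hf : HasLocalRule F f) (hF : Function.Surjective F) :
    ⨅ j, (component f j).ker = ⊥ := by
  have key (u : Fin m) : ∃ (t : Fin m) (j : Window ρ) (φ : S t ≃* S u),
      ∀ x, f x u = φ (x j t) := by
    rcases localRule_eq_one_or_exists_factor hnonab hiso f u with h | ⟨j, t, φ, h⟩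
    · obtain ⟨a, ha⟩ := exists_ne (1 : S u)
      obtain ⟨c, hc⟩ := hF fun _ => Pi.mulSingle u a
      have := congrFun (congrFun hc 0) u
      rw [hf, h, Pi.mulSingle_eq_same] at this
      exact absurd this.symm ha
    · exact ⟨t, j, φ, h⟩
  choose s w φ h using key
  have hs : Function.Injective s := by
    intro u v huv
    by_contra hne
    obtain ⟨a, ha⟩ := exists_ne (1 : S u)
    obtain ⟨c, hc⟩ := hF fun _ => Pi.mulSingle u a
    have hv (i : ℤ) : c i (s v) = 1 := by
      have := congrFun (congrFun hc (i - w v)) v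
      rw [hf, h, Pi.mulSingle_eq_of_ne (Ne.symm hne), map_eq_one_iff _ (φ v).injective] at this
      simpa using this
    have hu := congrFun (congrFun hc 0) u
    rw [hf, h, Pi.mulSingle_eq_same] at hu
    rw [← huv] at hv
    rw [hv, map_one] at hu
    exact ha hu.symm
  rw [eq_bot_iff]
  intro g hg
  rw [Subgroup.mem_iInf] at hg
  rw [Subgroup.mem_bot]
  funext t
  obtain ⟨u, rfl⟩ := (Finite.injective_iff_bijective.1 hs).2 t
  have h1 : component f (w u) g u = 1 := congrFun (hg (w u)) u
  have h2 := (h u (Pi.mulSingle (w u) g)).symm.trans h1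
  rwa [Pi.mulSingle_eq_same, map_eq_one_iff _ (φ u).injective] at h2

end Existence

/-- Each output cell sees the one non-trivial cell through at most one window position, so its value
is some `component f j g` or `1`. -/
theorem HasLocalRule.map_mulSingle_eq_one {G : Type*} [Group G] {ρ : ℕ}
    {F : (ℤ → G) →* (ℤ → G)} {f : (Window ρ → G) →* G} (hf : HasLocalRule F f) {g : G}
    (hg : g ∈ ⨅ j, (component f j).ker) (n : ℤ) : F (Pi.mulSingle n g) = 1 := by
  rw [Subgroup.mem_iInf] at hg
  funext i
  rw [hf]
  by_cases h : n - i ∈ Finset.Icc (-(ρ : ℤ)) ρ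
  · refine Eq.trans (congrArg f ?_) (hg ⟨n - i, h⟩)
    funext j
    by_cases hj : j = ⟨n - i, h⟩
    · subst hj
      simp
    · rw [Pi.mulSingle_eq_of_ne]
      · simp [Pi.mulSingle_eq_of_ne hj]
      · intro e
        exact hj (Subtype.ext (by simp [← e]))
  · refine Eq.trans (congrArg f ?_) (map_one f)
    funext j
    refine Pi.mulSingle_eq_of_ne (fun e => h ?_) _
    rw [← e, add_sub_cancel_left]
    exact j.2

namespace IsTrackRule

variable {ρ : ℕ} {f : (Window ρ → ∀ t, S t) →* (∀ t, S t)} {π : Equiv.Perm (Fin m)}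
  {w : Fin m → Window ρ} {φ : ∀ t, S t ≃* S (π t)}

theorem component_apply (h : IsTrackRule f π w φ) (j : Window ρ) (x : ∀ t, S t) (t : Fin m) :
    component f j x (π t) = if w t = j then φ t (x t) else 1 := by
  refine (h _ t).trans ?_
  split_ifs with hj
  · subst hj
    simp
  · simp [Pi.mulSingle_eq_of_ne hj]

theorem mem_range_component (h : IsTrackRule f π w φ) (j : Window ρ) (g : ∀ t, S t) :
    g ∈ (component f j).range ↔ ∀ t, w t ≠ j → g (π t) = 1 := by
  constructor
  · rintro ⟨x, rfl⟩ t ht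
    rw [h.component_apply, if_neg ht]
  · intro hg
    refine ⟨fun t => (φ t).symm (g (π t)), funext fun u => ?_⟩
    obtain ⟨t, rfl⟩ := π.surjective u
    rw [h.component_apply]
    split_ifs with ht
    · simp
    · exact (hg t ht).symm

theorem imageFactors_component [∀ t, Nontrivial (S t)] (h : IsTrackRule f π w φ) (j : Window ρ) :
    imageFactors (component f j) = π '' {t | w t = j} := by
  ext u
  obtain ⟨t, rfl⟩ := π.surjective u
  rw [π.injective.mem_set_image]
  constructor
  · intro hu
    by_contra ht
    obtain ⟨a, ha⟩ := exists_ne (1 : S (π t))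
    have hmem : (Pi.mulSingle (π t) a : ∀ t, S t) ∈ subproduct S {π t} := fun v hv =>
      Pi.mulSingle_eq_of_ne hv a
    have := (h.mem_range_component j _).1 (hu hmem) t ht
    rw [Pi.mulSingle_eq_same] at this
    exact ha this
  · intro ht g hg
    rw [h.mem_range_component]
    intro s hs
    refine hg _ fun e => hs ?_
    rw [π.injective e]
    exact ht

theorem range_component [∀ t, Nontrivial (S t)] (h : IsTrackRule f π w φ) (j : Window ρ) :
    (component f j).range = subproduct S (imageFactors (component f j)) := by
  ext g
  rw [h.mem_range_component, h.imageFactors_component]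
  refine ⟨fun hg u hu => ?_, fun hg t ht => hg _ ?_⟩
  · obtain ⟨t, rfl⟩ := π.surjective u
    rw [π.injective.mem_set_image] at hu
    exact hg t hu
  · rwa [π.injective.mem_set_image]

/-- The image of the component at `j` consists of the `π`-images of the factors with `w t = j`;
group the factors by `w`. -/
theorem weightedSum_eq [∀ t, Nontrivial (S t)] (h : IsTrackRule f π w φ) :
    weightedSum f = ∑ t, (w t : ℤ) := by
  classical
  rw [← Finset.sum_fiberwise (s := Finset.univ) (g := w)]
  refine Finset.sum_congr rfl fun j _ => ?_
  rw [h.imageFactors_component, Set.ncard_image_of_injective _ π.injective,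
    Finset.sum_congr rfl (g := fun _ => (j : ℤ)) (fun t ht => by rw [(Finset.mem_filter.1 ht).2])]
  rw [Finset.sum_const, nsmul_eq_mul, mul_comm, ← Set.ncard_coe_finset]
  simp

theorem isFactorPerm_iff [∀ t, Nontrivial (S t)] (h : IsTrackRule f π w φ)
    (π' : Equiv.Perm (Fin m)) : IsFactorPerm f π' ↔ π' = π := by
  constructor
  · intro h'
    ext1 t
    obtain ⟨j, hj⟩ := h' t
    obtain ⟨s, hs⟩ := π.surjective (π' t)
    obtain ⟨a, ha⟩ := exists_ne (1 : S (π' t))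
    have hmem : (Pi.mulSingle (π' t) a : ∀ t, S t) ∈ subproduct S {π' t} := fun v hv =>
      Pi.mulSingle_eq_of_ne hv a
    rw [← hj] at hmem
    obtain ⟨x, hx, hxa⟩ := hmem
    by_contra hne
    have hst : s ≠ t := by
      rintro rfl
      exact hne hs.symm
    have h1 : component f j x (π s) = 1 := by
      rw [h.component_apply, hx s hst, map_one, ite_self]
    rw [hs, hxa, Pi.mulSingle_eq_same] at h1
    exact ha h1
  · rintro rfl t
    refine ⟨w t, ?_⟩
    ext g
    constructor
    · rintro ⟨x, hx, rfl⟩ u hu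
      obtain ⟨s, rfl⟩ := π'.surjective u
      have hst : s ≠ t := by
        rintro rfl
        exact hu rfl
      rw [h.component_apply, hx s hst, map_one, ite_self]
    · intro hg
      refine ⟨Pi.mulSingle t ((φ t).symm (g (π' t))), fun s hs => Pi.mulSingle_eq_of_ne hs _, ?_⟩
      funext u
      obtain ⟨s, rfl⟩ := π'.surjective u
      rw [h.component_apply]
      by_cases hst : s = t
      · subst hst
        simp
      · rw [Pi.mulSingle_eq_of_ne hst, map_one, ite_self, hg]
        exact fun e => hst (π'.injective e)

variable {F : (ℤ → ∀ t, S t) →* (ℤ → ∀ t, S t)}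

theorem apply (h : IsTrackRule f π w φ) (hf : HasLocalRule F f) (c : ℤ → ∀ t, S t) (i : ℤ)
    (t : Fin m) : F c i (π t) = φ t (c (i + w t) t) := by
  rw [hf, h]

theorem bijective (h : IsTrackRule f π w φ) (hf : HasLocalRule F f) : Function.Bijective F := by
  constructor
  · rw [injective_iff_map_eq_one]
    intro c hc
    funext i t
    have := congrFun (congrFun hc (i - w t)) (π t)
    rw [h.apply hf, sub_add_cancel] at this
    exact (map_eq_one_iff _ (φ t).injective).1 this
  · intro d
    refine ⟨fun i t => (φ t).symm (d (i - w t) (π t)), funext fun i => funext fun u => ?_⟩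
    obtain ⟨t, rfl⟩ := π.surjective u
    rw [h.apply hf]
    simp

end IsTrackRule

section Existence

variable [∀ t, Finite (S t)] [∀ t, IsSimpleGroup (S t)] {ρ : ℕ}
  {f : (Window ρ → ∀ t, S t) →* (∀ t, S t)} {F : (ℤ → ∀ t, S t) →* (ℤ → ∀ t, S t)}

theorem surjective_iff_iInf_ker_eq_bot (hnonab : ∀ t, ¬ ∀ a b : S t, a * b = b * a)
    (hiso : ∀ s t, Nonempty (S s ≃* S t)) (hf : HasLocalRule F f) :
    Function.Surjective F ↔ ⨅ j, (component f j).ker = ⊥ := by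
  refine ⟨iInf_ker_eq_bot_of_surjective hnonab hiso hf, fun hker => ?_⟩
  obtain ⟨π, w, φ, h⟩ := exists_isTrackRule hnonab hiso hker
  exact (h.bijective hf).2

theorem injective_iff_surjective (hnonab : ∀ t, ¬ ∀ a b : S t, a * b = b * a)
    (hiso : ∀ s t, Nonempty (S s ≃* S t)) (hf : HasLocalRule F f) :
    Function.Injective F ↔ Function.Surjective F := by
  rw [surjective_iff_iInf_ker_eq_bot hnonab hiso hf]
  constructor
  · intro hF
    rw [eq_bot_iff]
    intro g hg
    have := hF ((hf.map_mulSingle_eq_one hg 0).trans (map_one F).symm)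
    simpa using this
  · intro hker
    obtain ⟨π, w, φ, h⟩ := exists_isTrackRule hnonab hiso hker
    exact (h.bijective hf).1

end Existence

end Track

end GCA

namespace GCA

/-! ### Displacement along the cycle of factors -/

section Drift

variable {m : ℕ}

/-- The total displacement of track `t` after `k` steps. -/
def drift (π : Equiv.Perm (Fin m)) (v : Fin m → ℤ) (k : ℕ) (t : Fin m) : ℤ :=
  ∑ s ∈ Finset.range k, v (π^[s] t)

variable {π : Equiv.Perm (Fin m)} {v : Fin m → ℤ}

theorem drift_succ (k : ℕ) (t : Fin m) : drift π v (k + 1) t = drift π v k (π t) + v t := by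
  rw [drift, Finset.sum_range_succ']
  rfl

theorem drift_add (a b : ℕ) (t : Fin m) :
    drift π v (a + b) t = drift π v a t + drift π v b (π^[a] t) := by
  rw [drift, Finset.sum_range_add]
  congr 1
  refine Finset.sum_congr rfl fun s _ => ?_
  rw [add_comm, Function.iterate_add_apply]

theorem abs_drift_le {B : ℕ} (hv : ∀ t, |v t| ≤ B) (k : ℕ) (t : Fin m) :
    |drift π v k t| ≤ k * B := by
  refine (Finset.abs_sum_le_sum_abs _ _).trans ?_
  simpa using Finset.sum_le_card_nsmul (Finset.range k) (fun s => |v (π^[s] t)|) B fun s _ => hv _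

variable (hπ : π.IsCycleOn Set.univ)
include hπ

theorem iterate_card_apply (t : Fin m) : π^[m] t = t := by
  rw [← Finset.coe_univ] at hπ
  simpa [Equiv.Perm.coe_pow] using hπ.pow_card_apply (Finset.mem_univ t)

theorem iterate_card_mul_apply (k : ℕ) (t : Fin m) : π^[m * k] t = t := by
  rw [Function.iterate_mul]
  exact Function.iterate_fixed (iterate_card_apply hπ t) k

theorem orderOf_eq_card [NeZero m] : orderOf π = m := by
  refine Nat.dvd_antisymm (orderOf_dvd_of_pow_eq_one ?_) ?_
  · ext1 t
    simpa [Equiv.Perm.coe_pow] using iterate_card_apply hπ t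
  · have h := hπ
    rw [← Finset.coe_univ] at h
    simpa using (h.pow_apply_eq (Finset.mem_univ (0 : Fin m))).1
      (by rw [pow_orderOf_eq_one]; rfl : (π ^ orderOf π) 0 = 0)

/-- One full turn of the cycle visits every factor exactly once. -/
theorem drift_card (t : Fin m) : drift π v m t = ∑ s, v s := by
  have h := hπ
  rw [← Finset.coe_univ] at h
  have hinj : Set.InjOn (fun s => π^[s] t) (Finset.range m : Set ℕ) := by
    intro a ha b hb hab
    have := (h.pow_apply_eq_pow_apply (Finset.mem_univ t) (m := a) (n := b)).1
      (by simpa [Equiv.Perm.coe_pow] using hab)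
    rw [Finset.card_univ, Fintype.card_fin] at this
    exact this.eq_of_lt_of_lt (by simpa using ha) (by simpa using hb)
  rw [drift, ← Finset.sum_image (f := v) hinj]
  congr 1
  rw [← Finset.card_eq_iff_eq_univ, Finset.card_image_of_injOn hinj]
  simp

theorem drift_card_mul (k : ℕ) (t : Fin m) : drift π v (m * k) t = k * ∑ s, v s := by
  induction k with
  | zero => simp [drift]
  | succ k ih =>
    rw [Nat.mul_succ, drift_add, ih, drift_card hπ]
    push_cast
    ring

/-- Full turns contribute the total exactly; the error is the drift of the `k % m` leftover steps.
-/
theorem exists_drift_eq [NeZero m] {B : ℕ} (hv : ∀ t, |v t| ≤ B) (k : ℕ) (t : Fin m) :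
    ∃ e : ℤ, |e| ≤ (m * B : ℕ) ∧ drift π v k t = (k / m : ℕ) * ∑ s, v s + e := by
  refine ⟨drift π v (k % m) t, (abs_drift_le hv _ _).trans ?_, ?_⟩
  · exact_mod_cast Nat.mul_le_mul_right B (Nat.mod_lt k (NeZero.pos m)).le
  · conv_lhs => rw [← Nat.div_add_mod k m]
    rw [drift_add, drift_card_mul hπ, iterate_card_mul_apply hπ]

end Drift

/-! ### Iterates of a track rule -/

section Track

variable {m : ℕ} {S : Fin m → Type*} [∀ t, Group (S t)] {ρ : ℕ}
  {f : (Window ρ → ∀ t, S t) →* (∀ t, S t)} {π : Equiv.Perm (Fin m)}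
  {w : Fin m → Window ρ} {φ : ∀ t, S t ≃* S (π t)} {F : (ℤ → ∀ t, S t) →* (ℤ → ∀ t, S t)}

namespace IsTrackRule

/-- Two cycles would let one cycle and its complement contradict minimality. -/
theorem isCycleOn (h : IsTrackRule f π w φ) (hf : HasLocalRule F f) (hmin : IsMinimalFor F) :
    π.IsCycleOn Set.univ := by
  refine ⟨Set.bijOn_univ.2 π.bijective, fun s _ t _ => ?_⟩
  by_contra hst
  have hpres (I : Set (Fin m)) (hI : ∀ t, π t ∈ I ↔ t ∈ I) : Preserves F (subproduct S I) := by
    intro c hc i u hu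
    obtain ⟨t, rfl⟩ := π.surjective u
    rw [h.apply hf, hc _ t (fun ht => hu ((hI t).2 ht)), map_one]
  refine hmin ⟨{t | π.SameCycle s t}, {t | π.SameCycle s t}ᶜ, ⟨s, Equiv.Perm.SameCycle.refl π s⟩,
    ⟨t, hst⟩, disjoint_compl_right, Set.union_compl_self _, hpres _ fun t => ?_,
    hpres _ fun t => ?_⟩
  · exact Equiv.Perm.sameCycle_apply_right
  · exact not_congr Equiv.Perm.sameCycle_apply_right

theorem iterate_apply (h : IsTrackRule f π w φ) (hf : HasLocalRule F f) (k : ℕ) (t : Fin m) :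
    ∃ ψ : S t ≃* S (π^[k] t), ∀ c i,
      F^[k] c i (π^[k] t) = ψ (c (i + drift π (fun s => (w s : ℤ)) k t) t) := by
  induction k generalizing t with
  | zero => exact ⟨MulEquiv.refl _, fun c i => by simp [drift]; rfl⟩
  | succ k ih =>
    obtain ⟨ψ, hψ⟩ := ih (π t)
    refine ⟨(φ t).trans ψ, fun c i => ?_⟩
    rw [drift_succ, ← add_assoc]
    refine (hψ (F c) i).trans ?_
    rw [h.apply hf]
    rfl

theorem iterate_apply_eq_iff (h : IsTrackRule f π w φ) (hf : HasLocalRule F f) (k : ℕ)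
    (t : Fin m) (c c' : ℤ → ∀ t, S t) (i : ℤ) :
    F^[k] c i (π^[k] t) = F^[k] c' i (π^[k] t) ↔
      c (i + drift π (fun s => (w s : ℤ)) k t) t = c' (i + drift π (fun s => (w s : ℤ)) k t) t := by
  obtain ⟨ψ, hψ⟩ := h.iterate_apply hf k t
  rw [hψ, hψ, ψ.injective.eq_iff]

/-- After a multiple of `m` steps a minimal automaton is a shift followed by automorphisms of the
factors. -/
theorem iterate_mul_apply (h : IsTrackRule f π w φ) (hf : HasLocalRule F f)
    (hπ : π.IsCycleOn Set.univ) (k : ℕ) (t : Fin m) :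
    ∃ ψ : S t ≃* S t, ∀ c i, F^[m * k] c i t = ψ (c (i + k * ∑ s, (w s : ℤ)) t) := by
  have := h.iterate_apply hf (m * k) t
  rwa [iterate_card_mul_apply hπ, drift_card_mul hπ] at this

theorem iterate_mul_eq_iff (h : IsTrackRule f π w φ) (hf : HasLocalRule F f)
    (hπ : π.IsCycleOn Set.univ) (k : ℕ) (c c' : ℤ → ∀ t, S t) (i : ℤ) :
    F^[m * k] c i = F^[m * k] c' i ↔
      c (i + k * ∑ s, (w s : ℤ)) = c' (i + k * ∑ s, (w s : ℤ)) := by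
  rw [funext_iff, funext_iff]
  refine forall_congr' fun t => ?_
  obtain ⟨ψ, hψ⟩ := h.iterate_mul_apply hf hπ k t
  rw [hψ, hψ, ψ.injective.eq_iff]

/-- The state at time `k` and position `i` only depends on the initial states at positions that are
within `mρ` of `i` shifted by the mean displacement. -/
theorem iterate_eq_of_forall_eq [NeZero m] (h : IsTrackRule f π w φ) (hf : HasLocalRule F f)
    (hπ : π.IsCycleOn Set.univ) (k : ℕ) (c c' : ℤ → ∀ t, S t) (i : ℤ)
    (hc : ∀ e : ℤ, |e| ≤ (m * ρ : ℕ) →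
      c (i + ((k / m : ℕ) * ∑ s, (w s : ℤ) + e)) = c' (i + ((k / m : ℕ) * ∑ s, (w s : ℤ) + e))) :
    F^[k] c i = F^[k] c' i := by
  funext u
  obtain ⟨t, rfl⟩ := (π.surjective.iterate k) u
  rw [h.iterate_apply_eq_iff hf]
  obtain ⟨e, he, hd⟩ := exists_drift_eq (v := fun s => (w s : ℤ)) hπ (B := ρ)
    (fun s => abs_le.2 (Finset.mem_Icc.1 (w s).2)) k t
  rw [hd, hc e he]

end IsTrackRule

end Track

end GCA

namespace GCA

/-! ### Topology and metric in terms of agreement on intervals -/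

section Config

variable {G : Type*}

/-- Agreement of two configurations on `[-L, L]`. -/
def agreeRel (G : Type*) (L : ℕ) : SetRel (ℤ → G) (ℤ → G) :=
  {p | ∀ i : ℤ, |i| ≤ L → p.1 i = p.2 i}

theorem hasBasis_agreeRel :
    (@uniformity _ (prodiscreteUniformity G)).HasBasis (fun _ : ℕ => True) (agreeRel G) := by
  let : UniformSpace G := ⊥
  have hunif : uniformity (ℤ → G) = ⨅ i : ℤ, Filter.principal {p | p.1 i = p.2 i} := by
    rw [Pi.uniformity]
    refine iInf_congr fun i => ?_
    rw [show uniformity G = Filter.principal SetRel.id from bot_uniformity, Filter.comap_principal]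
    rfl
  rw [hunif]
  refine (Filter.hasBasis_iInf_principal_finite _).to_hasBasis (fun t ht => ?_) fun L _ => ?_
  · obtain ⟨L, hL⟩ := (ht.image Int.natAbs).bddAbove
    refine ⟨L, trivial, fun p hp => Set.mem_iInter₂.2 fun i hi => hp i ?_⟩
    rw [Int.abs_eq_natAbs]
    exact_mod_cast hL (Set.mem_image_of_mem _ hi)
  · refine ⟨Set.Icc (-(L : ℤ)) L, Set.finite_Icc _ _, fun p hp i hi => ?_⟩
    exact Set.mem_iInter₂.1 hp i (abs_le.1 hi)

theorem isOpen_prodiscrete_iff {U : Set (ℤ → G)} :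
    @IsOpen _ (prodiscrete G) U ↔
      ∀ c ∈ U, ∃ L : ℕ, ∀ c', (∀ i : ℤ, |i| ≤ L → c i = c' i) → c' ∈ U := by
  let := prodiscreteUniformity G
  rw [isOpen_iff_mem_nhds]
  refine forall₂_congr fun c _ => ?_
  rw [(nhds_basis_uniformity' hasBasis_agreeRel).mem_iff]
  simp only [true_and]
  rfl

theorem isOpen_compl_singleton_prodiscrete (c : ℤ → G) : @IsOpen _ (prodiscrete G) {c}ᶜ := by
  rw [isOpen_prodiscrete_iff]
  intro d hd
  obtain ⟨i, hi⟩ := Function.ne_iff.1 hd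
  refine ⟨i.natAbs, fun d' hd' e => hi ?_⟩
  rw [hd' i (Int.abs_eq_natAbs i).le, e]

theorem isClosed_range_prodiscrete [Finite G] {F : (ℤ → G) → (ℤ → G)}
    (hF : @Continuous _ _ (prodiscrete G) (prodiscrete G) F) :
    @IsClosed _ (prodiscrete G) (Set.range F) := by
  let : UniformSpace G := ⊥
  have : DiscreteTopology G := ⟨rfl⟩
  exact (isCompact_range hF).isClosed

theorem tychonoffDist_pos_iff {c c' : ℤ → G} : 0 < tychonoffDist c c' ↔ c ≠ c' := by
  rw [tychonoffDist]
  split_ifs with h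
  · simp [h]
  · simp only [ne_eq, h, not_false_eq_true, iff_true]
    positivity

theorem pow_le_tychonoffDist_iff {c c' : ℤ → G} {n : ℕ} :
    (1 / 2 : ℝ) ^ n ≤ tychonoffDist c c' ↔ ∃ j : ℤ, |j| ≤ n ∧ c j ≠ c' j := by
  rw [tychonoffDist]
  split_ifs with h
  · subst h
    simp
  · rw [pow_le_pow_iff_right_of_lt_one₀ (by norm_num) (by norm_num)]
    obtain ⟨i, hi⟩ := Function.ne_iff.1 h
    constructor
    · intro hn
      obtain ⟨j, hj, hne⟩ := Nat.sInf_mem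
        (⟨i.natAbs, i, rfl, hi⟩ : {n : ℕ | ∃ j : ℤ, j.natAbs = n ∧ c j ≠ c' j}.Nonempty)
      refine ⟨j, ?_, hne⟩
      rw [Int.abs_eq_natAbs, hj]
      exact_mod_cast hn
    · rintro ⟨j, hj, hne⟩
      rw [Int.abs_eq_natAbs] at hj
      exact le_trans (Nat.sInf_le (s := {n | ∃ j : ℤ, j.natAbs = n ∧ c j ≠ c' j}) ⟨j, rfl, hne⟩)
        (by exact_mod_cast hj)

theorem tychonoffDist_lt_pow {c c' : ℤ → G} {n : ℕ} (h : ∀ j : ℤ, |j| ≤ n → c j = c' j) :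
    tychonoffDist c c' < (1 / 2 : ℝ) ^ n := by
  rw [← not_le, pow_le_tychonoffDist_iff]
  push Not
  exact h

/-- By compactness the range is closed, so its complement is an open set never entered at a positive
time. -/
theorem IsTransitive.surjective [Finite G] {F : (ℤ → G) → (ℤ → G)} (hF : IsCA F)
    (h : IsTransitive F) : Function.Surjective F := by
  by_contra hns
  rw [← Set.range_eq_univ, ← Set.compl_empty_iff, ← ne_eq, ← Set.nonempty_iff_ne_empty] at hns
  obtain ⟨c, hc⟩ := hns
  obtain ⟨k, hk, d, ⟨e, -, rfl⟩, hd⟩ := h Set.univ (Set.range F)ᶜ (@isOpen_univ _ (prodiscrete G))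
    (@IsClosed.isOpen_compl _ (prodiscrete G) _ (isClosed_range_prodiscrete hF.1)) ⟨c, trivial⟩
    ⟨c, hc⟩
  obtain ⟨k, rfl⟩ := Nat.exists_eq_succ_of_ne_zero hk.ne'
  rw [Function.iterate_succ_apply'] at hd
  exact hd ⟨_, rfl⟩

/-- A self-map of `G^ℤ` with a fixed point that is injective as soon as it is surjective is not
strongly transitive. -/
theorem not_isStronglyTransitive [Nontrivial G] {F : (ℤ → G) → (ℤ → G)}
    (hF : Function.Surjective F → Function.Injective F) {p : ℤ → G} (hp : F p = p) :
    ¬ IsStronglyTransitive F := by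
  -- It suffices to find a point with no preimage other than itself at any time: a fixed point if
  -- `F` is injective, a point outside the range if `F` is not surjective.
  have key (c : ℤ → G) (hc : ∀ k : ℕ, c ∉ F^[k] '' {c}ᶜ) : ¬ IsStronglyTransitive F := by
    intro h
    have := Set.eq_univ_iff_forall.1 (h _ (isOpen_compl_singleton_prodiscrete c)
      (exists_ne c)) c
    obtain ⟨k, hk⟩ := Set.mem_iUnion.1 this
    exact hc k hk
  by_cases hs : Function.Surjective F
  · refine key p fun k => ?_
    rintro ⟨d, hd, hdp⟩
    exact hd (((hF hs).iterate k) (hdp.trans (Function.iterate_fixed hp k).symm))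
  · rw [Function.Surjective, not_forall] at hs
    obtain ⟨c, hc⟩ := hs
    refine key c fun k => ?_
    rintro ⟨d, hd, hdc⟩
    cases k with
    | zero => exact hd hdc
    | succ k =>
      rw [Function.iterate_succ_apply'] at hdc
      exact hc ⟨_, hdc⟩

end Config

/-! ### Transitivity, sensitivity and expansivity -/

section Track

variable {m : ℕ} {S : Fin m → Type*} [∀ t, Group (S t)] {ρ : ℕ}
  {f : (Window ρ → ∀ t, S t) →* (∀ t, S t)} {π : Equiv.Perm (Fin m)}
  {w : Fin m → Window ρ} {φ : ∀ t, S t ≃* S (π t)} {F : (ℤ → ∀ t, S t) →* (ℤ → ∀ t, S t)}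

theorem iterate_map_one {M : Type*} [Monoid M] (F : M →* M) (k : ℕ) : F^[k] 1 = 1 :=
  Function.iterate_fixed (map_one F) k

theorem not_isPositivelyExpansive_of_ker {g : ∀ t, S t} (hf : HasLocalRule F f)
    (hg : g ∈ ⨅ j, (component f j).ker) (hg1 : g ≠ 1) : ¬ IsPositivelyExpansive F := by
  rintro ⟨ε, hε, h⟩
  obtain ⟨n, hn⟩ := exists_pow_lt_of_lt_one hε (by norm_num : (1 / 2 : ℝ) < 1)
  -- Cell `n + 1` is just outside the observed interval at time `0`, and the perturbation is gone
  -- from time `1` on.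
  obtain ⟨k, hk⟩ := h (Pi.mulSingle (n + 1 : ℤ) g) 1 (by simpa using hg1)
  obtain ⟨j, hj, hne⟩ := pow_le_tychonoffDist_iff.1 (hn.le.trans hk)
  cases k with
  | zero => exact hne (Pi.mulSingle_eq_of_ne (by have := (abs_le.1 hj).2; omega) _)
  | succ k =>
    rw [Function.iterate_succ_apply, hf.map_mulSingle_eq_one hg, iterate_map_one,
      iterate_map_one] at hne
    exact hne rfl

namespace IsTrackRule

variable [NeZero m] (h : IsTrackRule f π w φ) (hf : HasLocalRule F f)
  (hπ : π.IsCycleOn Set.univ)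
include h hf hπ

theorem isTransitive (hN : ∑ t, (w t : ℤ) ≠ 0) : IsTransitive F := by
  rintro U V hU hV ⟨a, ha⟩ ⟨b, hb⟩
  obtain ⟨K, hK⟩ := isOpen_prodiscrete_iff.1 hU a ha
  obtain ⟨L, hL⟩ := isOpen_prodiscrete_iff.1 hV b hb
  set N := ∑ t, (w t : ℤ) with hNdef
  -- Since `|N| ≥ 1`, this moves `[-L, L]` off `[-K, K]`, so `c` can equal `a` near `0` and still be
  -- prescribed on the cells that produce `b`.
  let k := K + L + 1
  choose ψ hψ using h.iterate_mul_apply hf hπ k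
  let c : ℤ → ∀ t, S t := fun i =>
    if |i| ≤ K then a i else fun t => (ψ t).symm (b (i - k * N) t)
  refine ⟨m * k, Nat.mul_pos (NeZero.pos m) (Nat.succ_pos _), F^[m * k] c,
    ⟨c, hK c fun i hi => (if_pos hi).symm, rfl⟩, hL _ fun i hi => funext fun t => ?_⟩
  have hfar : ¬ |i + k * N| ≤ K := by
    have h1 : (k : ℤ) * 1 ≤ |(k : ℤ) * N| := by
      rw [abs_mul, Nat.abs_cast]
      exact mul_le_mul_of_nonneg_left (Int.one_le_abs hN) (Int.natCast_nonneg k)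
    have h2 := abs_sub_abs_le_abs_sub ((k : ℤ) * N) (-i)
    rw [abs_neg, sub_neg_eq_add, add_comm _ i] at h2
    have h3 : (k : ℤ) = K + L + 1 := by simp [k]
    omega
  rw [hψ, ← hNdef]
  simp only [c, if_neg hfar]
  simp

theorem isSensitive [∀ t, Nontrivial (S t)] (hN : ∑ t, (w t : ℤ) ≠ 0) : IsSensitive F := by
  -- Distance at least `1` means a difference at cell `0`. A change at cell `(n + 1) * N`, outside
  -- `[-n, n]`, reaches it after `m * (n + 1)` steps.
  refine ⟨(1 / 2) ^ 0, by norm_num, fun δ hδ c => ?_⟩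
  obtain ⟨n, hn⟩ := exists_pow_lt_of_lt_one hδ (by norm_num : (1 / 2 : ℝ) < 1)
  set N := ∑ t, (w t : ℤ) with hNdef
  have hfar : (n : ℤ) < |((n + 1 : ℕ) : ℤ) * N| := by
    rw [abs_mul, Nat.abs_cast]
    have := mul_le_mul_of_nonneg_left (Int.one_le_abs hN) (Int.natCast_nonneg (n + 1))
    push_cast at this ⊢
    omega
  obtain ⟨a, ha⟩ := exists_ne (c (((n + 1 : ℕ) : ℤ) * N))
  have hne : Function.update c (((n + 1 : ℕ) : ℤ) * N) a ≠ c := fun e => ha (by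
    simpa using congrFun e (((n + 1 : ℕ) : ℤ) * N))
  refine ⟨Function.update c (((n + 1 : ℕ) : ℤ) * N) a, tychonoffDist_pos_iff.2 hne,
    (tychonoffDist_lt_pow fun j hj => ?_).trans hn, m * (n + 1),
    pow_le_tychonoffDist_iff.2 ⟨0, by simp, ?_⟩⟩
  · refine Function.update_of_ne ?_ _ _
    rintro rfl
    omega
  · rw [ne_eq, h.iterate_mul_eq_iff hf hπ, ← hNdef, zero_add, Function.update_self]
    exact ha

/-- With zero mean displacement the automaton is equicontinuous. -/
theorem iterate_eq_of_sum_eq_zero (hN : ∑ t, (w t : ℤ) = 0) {c c' : ℤ → ∀ t, S t} {L : ℕ}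
    (hc : ∀ i : ℤ, |i| ≤ (L + m * ρ : ℕ) → c i = c' i) (k : ℕ) (i : ℤ) (hi : |i| ≤ L) :
    F^[k] c i = F^[k] c' i := by
  refine h.iterate_eq_of_forall_eq hf hπ k c c' i fun e he => hc _ ?_
  rw [hN, mul_zero, zero_add, Nat.cast_add]
  exact (abs_add_le _ _).trans (add_le_add hi he)

theorem not_isTransitive [∀ t, Nontrivial (S t)] (hN : ∑ t, (w t : ℤ) = 0) :
    ¬ IsTransitive F := by
  intro htr
  obtain ⟨g, hg⟩ := exists_ne (1 : ∀ t, S t)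
  -- Configurations trivial within `m * ρ` of `0` stay trivial at cell `0` forever.
  obtain ⟨k, -, d, ⟨c, hc, rfl⟩, hd⟩ := htr
    {c | ∀ i : ℤ, |i| ≤ (0 + m * ρ : ℕ) → c i = (1 : ℤ → ∀ t, S t) i} {c | c 0 ≠ 1}
    (isOpen_prodiscrete_iff.2 fun c hc => ⟨_, fun c' hc' i hi => (hc' i hi).symm.trans (hc i hi)⟩)
    (isOpen_prodiscrete_iff.2 fun c hc => ⟨0, fun c' hc' e =>
      hc ((hc' 0 (by simp)).trans e)⟩)
    ⟨1, fun _ _ => rfl⟩ ⟨fun _ => g, hg⟩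
  refine hd ((h.iterate_eq_of_sum_eq_zero hf hπ hN hc k 0 (by simp)).trans ?_)
  rw [iterate_map_one]
  rfl

theorem not_isSensitive (hN : ∑ t, (w t : ℤ) = 0) : ¬ IsSensitive F := by
  rintro ⟨ε, hε, hs⟩
  obtain ⟨n, hn⟩ := exists_pow_lt_of_lt_one hε (by norm_num : (1 / 2 : ℝ) < 1)
  obtain ⟨c, -, hc, k, hk⟩ := hs ((1 / 2) ^ (n + m * ρ)) (by positivity) 1
  obtain ⟨j, hj, hne⟩ := pow_le_tychonoffDist_iff.1 (hn.le.trans hk)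
  rw [← not_le, pow_le_tychonoffDist_iff] at hc
  push Not at hc
  exact hne (h.iterate_eq_of_sum_eq_zero hf hπ hN hc k j hj)

theorem not_isPositivelyExpansive [∀ t, Nontrivial (S t)] : ¬ IsPositivelyExpansive F := by
  rintro ⟨ε, hε, hp⟩
  obtain ⟨n, hn⟩ := exists_pow_lt_of_lt_one hε (by norm_num : (1 / 2 : ℝ) < 1)
  obtain ⟨g, hg⟩ := exists_ne (1 : ∀ t, S t)
  set N := ∑ t, (w t : ℤ) with hNdef
  -- The perturbation sits opposite to the reading drift, beyond the error `m * ρ`, so `[-n, n]`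
  -- never sees it.
  let x : ℤ := if 0 ≤ N then -(n + (m * ρ : ℕ) + 1) else n + (m * ρ : ℕ) + 1
  obtain ⟨k, hk⟩ := hp (Pi.mulSingle x g) 1 (by simpa using hg)
  obtain ⟨j, hj, hne⟩ := pow_le_tychonoffDist_iff.1 (hn.le.trans hk)
  refine hne (h.iterate_eq_of_forall_eq hf hπ k _ _ j fun e he => Pi.mulSingle_eq_of_ne ?_ _)
  rw [← hNdef]
  rw [abs_le] at hj he
  have hq : (0 : ℤ) ≤ (k / m : ℕ) := Int.natCast_nonneg _
  by_cases h0 : 0 ≤ N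
  · have := mul_nonneg hq h0
    simp only [x, if_pos h0]
    omega
  · have := mul_nonpos_of_nonneg_of_nonpos hq (not_le.1 h0).le
    simp only [x, if_neg h0]
    omega

end IsTrackRule

end Track

end GCA

namespace GCA

/-! ### Counting orbit segments -/

section Counting

open Dynamics

variable {G : Type*} [Finite G] (F : (ℤ → G) → (ℤ → G)) (L n : ℕ) (W : Finset ℤ)

/-- The configurations equal to `b` off `W` form a finite set of representatives for agreement
on `W`. -/
theorem exists_finset_extend (b : G) : ∃ s : Finset (ℤ → G), s.card = Nat.card G ^ W.card ∧
    (∀ c : ℤ → G, ∃ d ∈ s, ∀ i ∈ W, c i = d i) ∧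
    ∀ c ∈ s, ∀ d ∈ s, (∀ i ∈ W, c i = d i) → c = d := by
  classical
  have := Fintype.ofFinite G
  let E : (W → G) → ℤ → G := fun x i => if h : i ∈ W then x ⟨i, h⟩ else b
  have hE (x : W → G) (i : ℤ) (hi : i ∈ W) : E x i = x ⟨i, hi⟩ := dif_pos hi
  have hinj : Function.Injective E := fun x y hxy => funext fun i => by
    rw [← hE x i i.2, hxy, hE y i i.2]
  refine ⟨Finset.univ.image E, ?_, fun c => ⟨E fun i => c i, by simp, fun i hi => ?_⟩, ?_⟩
  · rw [Finset.card_image_of_injective _ hinj, Finset.card_univ]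
    simp
  · exact (hE (fun i => c i) i hi).symm
  · intro c hc d hd hcd
    obtain ⟨x, -, rfl⟩ := Finset.mem_image.1 hc
    obtain ⟨y, -, rfl⟩ := Finset.mem_image.1 hd
    congr 1
    funext i
    rw [← hE x i i.2, hcd i i.2, hE y i i.2]

/-- The cells of `W` determine the observed orbit segment, so one representative per pattern on `W`
covers. -/
theorem coverMincard_agreeRel_le [Nonempty G]
    (hW : ∀ c c' : ℤ → G, (∀ i ∈ W, c i = c' i) → ∀ k < n, ∀ i : ℤ, |i| ≤ L →
      F^[k] c i = F^[k] c' i) :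
    coverMincard F Set.univ (agreeRel G L) n ≤ (Nat.card G ^ W.card : ℕ) := by
  obtain ⟨s, hs, hcov, -⟩ := exists_finset_extend W (Classical.arbitrary G)
  rw [← hs]
  refine IsDynCoverOf.coverMincard_le_card fun c _ => ?_
  obtain ⟨d, hd, hcd⟩ := hcov c
  exact ⟨d, hd, mem_dynEntourage.2 fun k hk => hW c d hcd k hk⟩

/-- Conversely, if the observed segment determines `W`, representatives of distinct patterns have
disjoint dynamical balls and form a net. -/
theorem le_coverMincard_agreeRel [Nonempty G]
    (hW : ∀ c c' : ℤ → G, (∀ k < n, ∀ i : ℤ, |i| ≤ L → F^[k] c i = F^[k] c' i) →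
      ∀ i ∈ W, c i = c' i) :
    (Nat.card G ^ W.card : ℕ) ≤ coverMincard F Set.univ (agreeRel G L) n := by
  obtain ⟨s, hs, -, hsep⟩ := exists_finset_extend W (Classical.arbitrary G)
  rw [← hs]
  refine (IsDynNetIn.card_le_netMaxcard ⟨Set.subset_univ _, fun c hc d hd hne => ?_⟩).trans
    (netMaxcard_le_coverMincard F Set.univ n)
  refine Set.disjoint_left.2 fun e he he' => hne (hsep c hc d hd fun i hi => ?_)
  exact (hW c e (mem_dynEntourage.1 he) i hi).trans (hW d e (mem_dynEntourage.1 he') i hi).symm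

end Counting

/-! ### Exponential growth rates with a floor in the exponent -/

section Growth

theorem natCast_pow_eq_exp {g : ℕ} (hg : g ≠ 0) (k : ℕ) :
    ((g ^ k : ℕ) : ENNReal) = EReal.exp ((k * Real.log g : ℝ) : EReal) := by
  rw [EReal.exp_coe, mul_comm, ← Real.rpow_def_of_pos (by positivity), Real.rpow_natCast,
    ← Nat.cast_pow, ENNReal.ofReal_natCast]

theorem div_mul_log_le {g : ℕ} (M m n : ℕ) :
    ((M * (n / m) : ℕ) * Real.log g : ℝ) ≤ M * Real.log g / m * n := by
  have h1 : ((n / m : ℕ) : ℝ) ≤ n / m := Nat.cast_div_le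
  have h2 := mul_le_mul_of_nonneg_left h1 (mul_nonneg (Nat.cast_nonneg M) (Real.log_natCast_nonneg g))
  calc ((M * (n / m) : ℕ) * Real.log g : ℝ) = M * Real.log g * (n / m : ℕ) := by push_cast; ring
    _ ≤ _ := h2
    _ = _ := by ring

theorem le_div_mul_log {g : ℕ} (M : ℕ) {m : ℕ} (hm : 0 < m) (n : ℕ) :
    M * Real.log g / m * n ≤ ((M + M * (n / m) : ℕ) * Real.log g : ℝ) := by
  have h1 : (n : ℝ) / m ≤ (n / m : ℕ) + 1 := by
    rw [div_le_iff₀ (by positivity)]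
    have := (Nat.lt_mul_div_succ n hm).le
    rw [mul_comm] at this
    exact_mod_cast this
  have h2 := mul_le_mul_of_nonneg_left h1 (mul_nonneg (Nat.cast_nonneg M) (Real.log_natCast_nonneg g))
  calc M * Real.log g / m * n = M * Real.log g * (n / m) := by ring
    _ ≤ _ := h2
    _ = _ := by push_cast; ring

theorem expGrowthSup_le_of_le_pow {u : ℕ → ENNReal} {g : ℕ} (hg : g ≠ 0) (A M m : ℕ)
    (hu : ∀ n, u n ≤ (g ^ (A + M * (n / m)) : ℕ)) :
    ExpGrowth.expGrowthSup u ≤ ((M * Real.log g / m : ℝ) : EReal) := by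
  rw [← ExpGrowth.expGrowthSup_exp (a := ((M * Real.log g / m : ℝ) : EReal))]
  refine ExpGrowth.expGrowthSup_le_of_eventually_le (ENNReal.natCast_ne_top (g ^ A))
    (Filter.Eventually.of_forall fun n => (hu n).trans ?_)
  rw [pow_add, Nat.cast_mul, natCast_pow_eq_exp hg (M * (n / m))]
  refine mul_le_mul_right (EReal.exp_monotone ?_) _
  exact_mod_cast div_mul_log_le M m n

/-- Rounding `n / m` down costs at most the constant factor `g ^ M`, invisible to the growth rate.
-/
theorem le_expGrowthSup_of_pow_le {u : ℕ → ENNReal} {g : ℕ} (hg : g ≠ 0) (M : ℕ) {m : ℕ}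
    (hm : 0 < m) (hu : ∀ n, ((g ^ (M * (n / m)) : ℕ) : ENNReal) ≤ u n) :
    ((M * Real.log g / m : ℝ) : EReal) ≤ ExpGrowth.expGrowthSup u := by
  rw [← ExpGrowth.expGrowthSup_exp (a := ((M * Real.log g / m : ℝ) : EReal))]
  refine ExpGrowth.expGrowthSup_le_of_eventually_le (ENNReal.natCast_ne_top (g ^ M))
    (Filter.Eventually.of_forall fun n => le_trans ?_ (mul_le_mul_right (hu n) _))
  rw [← Nat.cast_mul, ← pow_add, natCast_pow_eq_exp hg]
  refine EReal.exp_monotone ?_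
  exact_mod_cast le_div_mul_log M hm n

end Growth

/-! ### The entropy -/

section Track

open Dynamics

variable {m : ℕ} {S : Fin m → Type*} [∀ t, Group (S t)] {ρ : ℕ}
  {f : (Window ρ → ∀ t, S t) →* (∀ t, S t)} {π : Equiv.Perm (Fin m)}
  {w : Fin m → Window ρ} {φ : ∀ t, S t ≃* S (π t)} {F : (ℤ → ∀ t, S t) →* (ℤ → ∀ t, S t)}

theorem IsTrackRule.topEntropy_eq [NeZero m] [∀ t, Finite (S t)] (h : IsTrackRule f π w φ)
    (hf : HasLocalRule F f) (hπ : π.IsCycleOn Set.univ) :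
    topEntropy F = (((∑ t, (w t : ℤ)).natAbs * Real.log (Nat.card (∀ t, S t)) / m : ℝ) : EReal) := by
  have hcard : Nat.card (∀ t, S t) ≠ 0 := Nat.card_pos.ne'
  have hm : 0 < m := NeZero.pos m
  rw [topEntropy, @coverEntropy_eq_iSup_basis _ (prodiscreteUniformity _) _ _ _ hasBasis_agreeRel]
  set N := ∑ t, (w t : ℤ) with hNdef
  -- The upper bound holds at every radius `L`; radius `|N|` already attains it.
  refine le_antisymm (iSup₂_le fun L _ => ?_) (le_iSup₂_of_le N.natAbs trivial ?_)
  · refine expGrowthSup_le_of_le_pow hcard (2 * (L + m * ρ) + 1) N.natAbs m fun n => ?_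
    let R : ℤ := (L + m * ρ : ℕ)
    -- All cells read before time `n`: the interval of radius `L + m * ρ`, swept by the drift.
    let W := Finset.Icc (-R + min 0 ((n / m : ℕ) * N)) (R + max 0 ((n / m : ℕ) * N))
    have hW : W.card = 2 * (L + m * ρ) + 1 + N.natAbs * (n / m) := by
      have habs : ((n / m : ℕ) * N : ℤ).natAbs = N.natAbs * (n / m) := by
        rw [Int.natAbs_mul, Int.natAbs_natCast, mul_comm]
      rw [Int.card_Icc, ← habs]
      simp only [R]
      omega
    have := coverMincard_agreeRel_le F L n W fun c c' hc k hk i hi => by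
      refine h.iterate_eq_of_forall_eq hf hπ k c c' i fun e he => hc _ ?_
      rw [← hNdef, Finset.mem_Icc]
      have hkn : ((k / m : ℕ) : ℤ) ≤ (n / m : ℕ) := by exact_mod_cast Nat.div_le_div_right hk.le
      have hk0 : (0 : ℤ) ≤ (k / m : ℕ) := Int.natCast_nonneg _
      rw [abs_le] at hi he
      simp only [R]
      rcases le_total 0 N with h0 | h0
      · have h1 := mul_le_mul_of_nonneg_right hkn h0
        have h2 := mul_nonneg hk0 h0
        omega
      · have h1 := mul_le_mul_of_nonpos_right hkn h0
        have h2 := mul_nonpos_of_nonneg_of_nonpos hk0 h0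
        omega
    rw [hW] at this
    exact_mod_cast ENat.toENNReal_mono this
  · refine le_expGrowthSup_of_pow_le hcard N.natAbs hm fun n => ?_
    -- At times `m * q` the observed window shows blocks of `|N|` consecutive cells that abut, hence
    -- all of `W`; for `N = 0` it is empty.
    let W := (Finset.range (N.natAbs * (n / m))).image fun y : ℕ => N.sign * y
    have hW : W.card = N.natAbs * (n / m) := by
      rw [Finset.card_image_of_injOn, Finset.card_range]
      intro y hy z hz hyz
      have hN : N.sign ≠ 0 := by
        intro e
        rw [Int.sign_eq_zero_iff_zero] at e
        simp [e] at hy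
      exact_mod_cast mul_left_cancel₀ hN hyz
    have := le_coverMincard_agreeRel F N.natAbs n W fun c c' hc i hi => by
      obtain ⟨y, hy, rfl⟩ := Finset.mem_image.1 hi
      rw [Finset.mem_range] at hy
      have hN : 0 < N.natAbs := Nat.pos_of_ne_zero fun e => by simp [e] at hy
      have hq : y / N.natAbs < n / m := Nat.div_lt_of_lt_mul hy
      have hkn : m * (y / N.natAbs) < n :=
        lt_of_lt_of_le (Nat.mul_lt_mul_of_pos_left hq hm) (Nat.mul_div_le n m)
      -- Euclidean division of `y` by `|N|`: the quotient gives the time, the remainder the observed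
      -- cell.
      have := (h.iterate_mul_eq_iff hf hπ (y / N.natAbs) c c' (N.sign * (y % N.natAbs : ℕ))).1
        (hc _ hkn _ ?_)
      · have e : N.sign * (y % N.natAbs : ℕ) + (y / N.natAbs : ℕ) * N = N.sign * y := by
          have h1 : ((N.natAbs : ℤ) * (y / N.natAbs : ℕ) + (y % N.natAbs : ℕ)) = y := by
            exact_mod_cast Nat.div_add_mod y N.natAbs
          conv_rhs => rw [← h1]
          rw [mul_add, ← mul_assoc, Int.sign_mul_natAbs]
          ring
        rwa [← hNdef, e] at this
      · rw [abs_mul, Nat.abs_cast]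
        have h1 : |N.sign| ≤ 1 := by
          rcases lt_trichotomy N 0 with h0 | h0 | h0
          · simp [Int.sign_eq_neg_one_of_neg h0]
          · simp [h0]
          · simp [Int.sign_eq_one_of_pos h0]
        calc |N.sign| * ((y % N.natAbs : ℕ) : ℤ) ≤ 1 * (y % N.natAbs : ℕ) :=
              mul_le_mul_of_nonneg_right h1 (Int.natCast_nonneg _)
          _ ≤ _ := by
            rw [one_mul]
            exact_mod_cast (Nat.mod_lt y hN).le
    rw [hW] at this
    exact_mod_cast ENat.toENNReal_mono this

end Track

end GCA

theorem mainTheorem5 {m : ℕ} (hm : 1 ≤ m) (S : Fin m → Type*) [∀ t, Group (S t)]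
    [∀ t, Finite (S t)] [∀ t, IsSimpleGroup (S t)]
    (hnonab : ∀ t, ¬ ∀ a b : S t, a * b = b * a)
    (hiso : ∀ s t, Nonempty (S s ≃* S t))
    (F : (ℤ → ∀ t, S t) →* (ℤ → ∀ t, S t)) (hF : GCA.IsCA F)
    {ρ : ℕ} (f : (GCA.Window ρ → ∀ t, S t) →* (∀ t, S t)) (hf : GCA.HasLocalRule F f)
    (hmin : GCA.IsMinimalFor F) :
    -- the quantities `r_j = |J_j|` and `o = orderOf π` below are well defined
    (Function.Surjective F →
      (∀ j, (GCA.component f j).range =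
        GCA.subproduct S (GCA.imageFactors (GCA.component f j))) ∧
      ∃! π : Equiv.Perm (Fin m), GCA.IsFactorPerm f π) ∧
    -- (1)
    ((Function.Injective F ↔ Function.Surjective F) ∧
      (Function.Surjective F ↔ ⨅ j, (GCA.component f j).ker = ⊥)) ∧
    -- (2)
    (GCA.IsTransitive F ↔ Function.Surjective F ∧ GCA.weightedSum f ≠ 0) ∧
    -- (3)
    (Function.Surjective F → (GCA.IsSensitive F ↔ GCA.IsTransitive F)) ∧
    -- (4)
    (Function.Surjective F → ∀ π : Equiv.Perm (Fin m), GCA.IsFactorPerm f π →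
      GCA.topEntropy F =
        ((|(GCA.weightedSum f : ℝ)| * Real.log (Nat.card (∀ t, S t)) / orderOf π : ℝ) : EReal)) ∧
    -- (5)
    (¬ GCA.IsStronglyTransitive F ∧ ¬ GCA.IsPositivelyExpansive F) := by
  have : NeZero m := ⟨by omega⟩
  have hbot : Function.Surjective F ↔ ⨅ j, (GCA.component f j).ker = ⊥ :=
    GCA.surjective_iff_iInf_ker_eq_bot hnonab hiso hf
  have hinj : Function.Injective F ↔ Function.Surjective F :=
    GCA.injective_iff_surjective hnonab hiso hf
  have hrule (hs : Function.Surjective F) : ∃ π w φ, GCA.IsTrackRule f π w φ :=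
    GCA.exists_isTrackRule hnonab hiso (hbot.1 hs)
  have htrans (hs : Function.Surjective F) : GCA.IsTransitive F ↔ GCA.weightedSum f ≠ 0 := by
    obtain ⟨π, w, φ, h⟩ := hrule hs
    rw [h.weightedSum_eq]
    exact ⟨fun ht hN => h.not_isTransitive hf (h.isCycleOn hf hmin) hN ht,
      h.isTransitive hf (h.isCycleOn hf hmin)⟩
  refine ⟨fun hs => ?_, ⟨hinj, hbot⟩, ⟨fun ht => ?_, fun ht => (htrans ht.1).2 ht.2⟩, fun hs => ?_,
    fun hs π' hπ' => ?_, GCA.not_isStronglyTransitive hinj.2 (map_one F), ?_⟩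
  · obtain ⟨π, w, φ, h⟩ := hrule hs
    exact ⟨h.range_component, π, (h.isFactorPerm_iff π).2 rfl, fun π' => (h.isFactorPerm_iff π').1⟩
  · have hs := ht.surjective hF
    exact ⟨hs, (htrans hs).1 ht⟩
  · rw [htrans hs]
    obtain ⟨π, w, φ, h⟩ := hrule hs
    rw [h.weightedSum_eq]
    exact ⟨fun ht hN => h.not_isSensitive hf (h.isCycleOn hf hmin) hN ht,
      h.isSensitive hf (h.isCycleOn hf hmin)⟩
  · obtain ⟨π, w, φ, h⟩ := hrule hs
    obtain rfl := (h.isFactorPerm_iff π').1 hπ'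
    have hπ := h.isCycleOn hf hmin
    rw [h.topEntropy_eq hf hπ, h.weightedSum_eq, GCA.orderOf_eq_card hπ, Nat.cast_natAbs,
      Int.cast_abs]
  -- Expansivity must be refuted without surjectivity; the non-surjective case uses an erased cell.
  · by_cases hker : ⨅ j, (GCA.component f j).ker = ⊥
    · obtain ⟨π, w, φ, h⟩ := hrule (hbot.2 hker)
      exact h.not_isPositivelyExpansive hf (h.isCycleOn hf hmin)
    · obtain ⟨⟨g, hg⟩, hg1⟩ := Subgroup.ne_bot_iff_exists_ne_one.1 hker
      exact GCA.not_isPositivelyExpansive_of_ker hf hg fun e => hg1 (Subtype.ext e)
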